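/- Let $M,N\ge 1$ and $q\ge 0$ be integers (the number of explorations per cycle; the main case is $q=3$), let $\mathbf{s}$ be a complex pilot vector and $\sigma_z>0$. For a parameter vector $\boldsymbol\psi=[\beta^{\mathrm{re}},\beta^{\mathrm{im}},x_1,x_2]^{\mathrm T}\in\mathbb{R}^4$ put $\beta=\beta^{\mathrm{re}}+j\beta^{\mathrm{im}}$, let $\mathbf{a}(\mathbf{x})=\mathbf{a}_1(x_1)\otimes\mathbf{a}_2(x_2)\in\mathbb{C}^{MN}$ with $\mathbf{a}_1(x_1)=[e^{j2\pi\frac{m}{M}x_1}]_{m=0}^{M-1}$ and $\mathbf{a}_2(x_2)=[e^{j2\pi\frac{n}{N}x_2}]_{n=0}^{N-1}$, and let $\mathbf{h}(\boldsymbol\psi)=\beta\,\mathbf{a}(\mathbf{x})$ be the channel vector. Given a beamforming matrix $\mathbf{W}\in\mathbb{C}^{MN\times q}$, an observation $\mathbf{y}\in\mathbb{C}^q$ has the $\mathcal{CN}(|\mathbf{s}|\beta\mathbf{W}^{\mathrm H}\mathbf{a}(\mathbf{x}),\sigma_z^2\mathbf{J}_q)$ density $$p_S(\mathbf{y}\mid\boldsymbol\psi,\mathbf{W})=\frac{1}{\pi^q\sigma_z^{2q}}\exp\Bigl(-\frac{\|\mathbf{y}-|\mathbf{s}|\beta\mathbf{W}^{\mathrm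 H}\mathbf{a}(\mathbf{x})\|_2^2}{\sigma_z^2}\Bigr).$$ Fix $\boldsymbol\psi$ (quasi-static case: $\boldsymbol\psi$ is the same in all cycles). (i) The Jacobian matrix $\mathbf{V}=\partial\mathbf{h}/\partial\boldsymbol\psi^{\mathrm T}$ at $\boldsymbol\psi$ equals $\left[\mathbf{a}(\mathbf{x}),\,j\mathbf{a}(\mathbf{x}),\,\beta\frac{\partial\mathbf{a}(\mathbf{x})}{\partial x_1},\,\beta\frac{\partial\mathbf{a}(\mathbf{x})}{\partial x_2}\right]$. (ii) For every $\mathbf{W}\in\mathbb{C}^{MN\times q}$ the Fisher information matrix exists and satisfies $$\mathbf{I}_S(\boldsymbol\psi,\mathbf{W})\triangleq\mathbb{E}\left[\frac{\partial\log p_S(\mathbf{y}|\boldsymbol\psi,\mathbf{W})}{\partial\boldsymbol\psi}\cdot\frac{\partial\log p_S(\mathbf{y}|\boldsymbol\psi,\mathbf{W})}{\partial\boldsymbol\psi^{\mathrm T}}\right]=\frac{2|\mathbf{s}|^2}{\sigma_z^2}\,\mathrm{Re}\{\mathbf{V}^{\mathrm H}\mathbf{W}\mathbf{W}^{\mathrm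 H}\mathbf{V}\}.$$ (iii) Let $\mathbf{W}_1,\dots,\mathbf{W}_k\in\mathbb{C}^{MN\times q}$ be given (fixed) beamforming matrices such that $\sum_{l=1}^k\mathbf{I}_S(\boldsymbol\psi,\mathbf{W}_l)$ is invertible, and let $\mathbf{y}_1,\dots,\mathbf{y}_k$ be independent, $\mathbf{y}_l$ with density $p_S(\cdot\mid\boldsymbol\psi,\mathbf{W}_l)$. Then $$C_S^t(\boldsymbol\psi,\mathbf{W}_1,\dots,\mathbf{W}_k)\triangleq\frac{1}{MN}\mathrm{Tr}\Bigl\{\Bigl(\sum_{l=1}^k\mathbf{I}_S(\boldsymbol\psi,\mathbf{W}_l)\Bigr)^{-1}\mathbf{V}^{\mathrm H}\mathbf{V}\Bigr\}$$ is real, and every estimate $\hat{\mathbf{h}}_k=\hat{\mathbf{h}}_k(\mathbf{y}_1,\dots,\mathbf{y}_k)\in\mathbb{C}^{MN}$ of the channel vector (in particular every one of the form $\hat\beta_k\mathbf{a}(\hat{\mathbf{x}}_k)$) that is unbiased, i.e. $\mathbb{E}[\hat{\mathbf{h}}_k]=\mathbf{h}(\boldsymbol\psi')$ under each true parameter $\boldsymbol\psi'$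 in some neighbourhood of $\boldsymbol\psi$, satisfies $$\frac{1}{MN}\mathbb{E}\bigl[\|\hat{\mathbf{h}}_k-\mathbf{h}(\boldsymbol\psi)\|_2^2\bigr]\ \ge\ C_S^t(\boldsymbol\psi,\mathbf{W}_1,\dots,\mathbf{W}_k),$$ where the expectation is taken under $\boldsymbol\psi$ and may be $+\infty$. -/

import Mathlib

open MeasureTheory

namespace BeamTracking

/-- The channel parameter vector `ψ = (Re β, Im β, x₁, x₂)`. -/
abbrev Param : Type := Fin 4 → ℝ

/-- The complex channel gain `β` of a parameter vector. -/
noncomputable def gain (ψ : Param) : ℂ := (ψ 0 : ℂ) + (ψ 1 : ℂ) * Complex.I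

/-- The one-dimensional steering vector of an array with `n` elements:
its entries are `exp (j 2π (m / n) t)` for `m = 0, …, n - 1`. -/
noncomputable def steering1 (n : ℕ) (t : ℝ) (m : Fin n) : ℂ :=
  Complex.exp (2 * Real.pi * Complex.I * (((m : ℕ) : ℂ) / (n : ℂ)) * (t : ℂ))

/-- The two-dimensional steering vector `a(x) = a₁(x₁) ⊗ a₂(x₂)`; the entries of the Kronecker
product of two vectors are indexed by pairs. -/
noncomputable def steering (M N : ℕ) (x₁ x₂ : ℝ) (p : Fin M × Fin N) : ℂ :=
  steering1 M x₁ p.1 * steering1 N x₂ p.2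

/-- The channel vector `h(ψ) = β a(x)`. -/
noncomputable def channel (M N : ℕ) (ψ : Param) (p : Fin M × Fin N) : ℂ :=
  gain ψ * steering M N (ψ 2) (ψ 3) p

/-- The Jacobian matrix `V = ∂h / ∂ψᵀ` at `ψ`. -/
noncomputable def jacobian (M N : ℕ) (ψ : Param) : Matrix (Fin M × Fin N) (Fin 4) ℂ :=
  Matrix.of fun p i => fderiv ℝ (fun φ : Param => channel M N φ p) ψ (Pi.single i 1)

/-- The mean `|s| β Wᴴ a(x)` of an observation vector; `r = |s|`, and the columns of `W` are
the `q` beamforming vectors. -/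
noncomputable def obsMean {M N q : ℕ} (r : ℝ) (W : Matrix (Fin M × Fin N) (Fin q) ℂ)
    (ψ : Param) : Fin q → ℂ :=
  (r : ℂ) • (W.conjTranspose.mulVec (channel M N ψ))

/-- The density `p_S(y | ψ, W)` of an observation vector `y ∼ CN(|s| β Wᴴ a(x), σ² I_q)`. -/
noncomputable def obsDensity {M N q : ℕ} (r σ : ℝ) (W : Matrix (Fin M × Fin N) (Fin q) ℂ)
    (ψ : Param) (y : Fin q → ℂ) : ℝ :=
  1 / (Real.pi ^ q * σ ^ (2 * q)) *
    Real.exp (-(∑ i, ‖y i - obsMean r W ψ i‖ ^ 2) / σ ^ 2)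

/-- The law of an observation vector, on `ℂ^q` with its Lebesgue measure. -/
noncomputable def obsLaw {M N q : ℕ} (r σ : ℝ) (W : Matrix (Fin M × Fin N) (Fin q) ℂ)
    (ψ : Param) : Measure (Fin q → ℂ) :=
  (volume : Measure (Fin q → ℂ)).withDensity fun y => ENNReal.ofReal (obsDensity r σ W ψ y)

/-- The joint law of the independent observation vectors `y₁, …, y_k`. -/
noncomputable def jointLaw {M N q k : ℕ} (r σ : ℝ)
    (W : Fin k → Matrix (Fin M × Fin N) (Fin q) ℂ) (ψ : Param) :
    Measure (Fin k → Fin q → ℂ) :=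
  Measure.pi fun l => obsLaw r σ (W l) ψ

/-- The score `∂ log p_S(y | ψ, W) / ∂ψ`. -/
noncomputable def score {M N q : ℕ} (r σ : ℝ) (W : Matrix (Fin M × Fin N) (Fin q) ℂ)
    (ψ : Param) (y : Fin q → ℂ) (i : Fin 4) : ℝ :=
  fderiv ℝ (fun φ : Param => Real.log (obsDensity r σ W φ y)) ψ (Pi.single i 1)

/-- The Fisher information matrix `I_S(ψ, W) = E[∂ log p_S / ∂ψ · ∂ log p_S / ∂ψᵀ]`. -/
noncomputable def fisher {M N q : ℕ} (r σ : ℝ) (W : Matrix (Fin M × Fin N) (Fin q) ℂ)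
    (ψ : Param) : Matrix (Fin 4) (Fin 4) ℝ :=
  Matrix.of fun i j => ∫ y, score r σ W ψ y i * score r σ W ψ y j ∂(obsLaw r σ W ψ)

/-- The estimate `g(y₁, …, y_k)` of the channel vector is unbiased when the true parameter
vector is `ψ`: its expectation exists and equals `h(ψ)`. -/
def UnbiasedAt {M N q k : ℕ} (r σ : ℝ) (W : Fin k → Matrix (Fin M × Fin N) (Fin q) ℂ)
    (g : (Fin k → Fin q → ℂ) → Fin M × Fin N → ℂ) (ψ : Param) : Prop :=
  ∀ p, Integrable (fun y => g y p) (jointLaw r σ W ψ) ∧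
    ∫ y, g y p ∂(jointLaw r σ W ψ) = channel M N ψ p

/-- The normalized mean square error `(1 / MN) E‖g(y₁, …, y_k) - h(ψ)‖²` of an estimate of the
channel vector, as an extended nonnegative number. -/
noncomputable def mse {M N q k : ℕ} (r σ : ℝ) (W : Fin k → Matrix (Fin M × Fin N) (Fin q) ℂ)
    (g : (Fin k → Fin q → ℂ) → Fin M × Fin N → ℂ) (ψ : Param) : ENNReal :=
  ENNReal.ofReal (1 / ((M : ℝ) * (N : ℝ))) *
    ∫⁻ y, ENNReal.ofReal (∑ p, ‖g y p - channel M N ψ p‖ ^ 2) ∂(jointLaw r σ W ψ)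

/-- The bound `(1 / MN) Tr{(∑ₗ I_S(ψ, Wₗ))⁻¹ (Vᴴ V)}`. -/
noncomputable def crlb {M N q k : ℕ} (r σ : ℝ) (W : Fin k → Matrix (Fin M × Fin N) (Fin q) ℂ)
    (ψ : Param) : ℂ :=
  1 / ((M : ℂ) * (N : ℂ)) *
    Matrix.trace ((∑ l, fisher r σ (W l) ψ)⁻¹.map Complex.ofReal *
      ((jacobian M N ψ).conjTranspose * jacobian M N ψ))

end BeamTracking

/-
The laws of the observations form a Gaussian shift family: moving the mean `m` by `Δ` multiplies
the law by the likelihood ratio `L_Δ(y) = exp (B(Δ, y - m) - B(Δ, Δ) / 2)`, where `B` is the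
precision form. Hence `∫ L_Δ L_Γ = exp B(Δ, Γ)`, and this identity determines all the moments that
are needed.

The score is `B(∂ᵢm, y - m)`, so the Fisher information matrix `J` is the Gram matrix of `B` on the
columns `∂ᵢm`. For the error bound no score is needed. The difference quotients
`Dᵢ = (L_{Δᵢ} - 1) / t`, where `Δᵢ` is the increment of the mean along the `i`-th coordinate,
satisfy `𝔼[Dᵢ Dⱼ] = (exp B(Δᵢ, Δⱼ) - 1) / t² → Jᵢⱼ`, and by unbiasedness `𝔼[Dᵢ ε]` is the difference
quotient of the estimated function `η`, where `ε` is the estimation error. Letting `t → 0` in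
`0 ≤ 𝔼‖ε - ∑ᵢ cᵢ Dᵢ‖²`, with the optimal `c = J⁻¹ ∂η`, gives the Cramér–Rao bound for each entry of
the channel vector; summing over the entries gives the trace.
-/

namespace BeamTracking

open Filter ProbabilityTheory Topology
open scoped ComplexConjugate Matrix ENNReal

section ChapmanRobbins

variable {Ω n : Type*} [MeasurableSpace Ω] {P : Measure Ω}

lemma memLp_complex_ofReal {f : Ω → ℝ} {p : ℝ≥0∞} (hf : MemLp f p P) :
    MemLp (fun x => (f x : ℂ)) p P :=
  hf.ofReal

lemma integrable_ofReal_mul {f : Ω → ℝ} {g : Ω → ℂ} (hf : MemLp f 2 P) (hg : MemLp g 2 P) :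
    Integrable (fun x => (f x : ℂ) * g x) P :=
  (memLp_complex_ofReal hf).integrable_mul hg

variable [Fintype n]

lemma integral_ofReal_mul_sum {X : Ω → ℝ} {S : n → Ω → ℝ} (hX : MemLp X 2 P)
    (hS : ∀ j, MemLp (S j) 2 P) (c : n → ℂ) :
    ∫ x, X x * ∑ j, S j x * c j ∂P = ∑ j, ((∫ x, X x * S j x ∂P : ℝ) : ℂ) * c j := by
  simp only [Finset.mul_sum]
  rw [integral_finsetSum _ fun j _ =>
    integrable_ofReal_mul hX ((memLp_complex_ofReal (hS j)).mul_const (c j))]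
  refine Finset.sum_congr rfl fun j _ => ?_
  rw [← integral_complex_ofReal, ← integral_mul_const]
  simp only [Complex.ofReal_mul, mul_assoc]

/-- This is `0 ≤ 𝔼‖ε - ∑ᵢ cᵢ Sᵢ‖²`, expanded. -/
lemma re_star_dotProduct_le_integral_norm_sq {S : n → Ω → ℝ} {ε : Ω → ℂ}
    (hS : ∀ i, MemLp (S i) 2 P) (hε : MemLp ε 2 P) (c : n → ℂ) :
    (star c ⬝ᵥ ((2 : ℂ) • (fun i => ∫ x, S i x * ε x ∂P) -
      (Matrix.of fun i j => ∫ x, S i x * S j x ∂P).map Complex.ofReal *ᵥ c)).re ≤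
      ∫ x, ‖ε x‖ ^ 2 ∂P := by
  set Z : Ω → ℂ := fun x => ∑ j, S j x * c j
  have hZ : MemLp Z 2 P :=
    memLp_finsetSum _ fun j _ => (memLp_complex_ofReal (hS j)).mul_const (c j)
  have hR : MemLp (fun x => 2 * ε x - Z x) 2 P := (hε.const_mul 2).sub hZ
  have hSR (i : n) : ∫ x, S i x * (2 * ε x - Z x) ∂P =
      2 * ∫ x, S i x * ε x ∂P - ∑ j, ((∫ x, S i x * S j x ∂P : ℝ) : ℂ) * c j := by
    rw [← integral_ofReal_mul_sum (hS i) hS, ← integral_const_mul,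
      ← integral_sub ((integrable_ofReal_mul (hS i) hε).const_mul 2)
        (integrable_ofReal_mul (hS i) hZ)]
    congr with x
    ring
  have hconj : star c ⬝ᵥ ((2 : ℂ) • (fun i => ∫ x, S i x * ε x ∂P) -
      (Matrix.of fun i j => ∫ x, S i x * S j x ∂P).map Complex.ofReal *ᵥ c) =
      ∫ x, conj (Z x) * (2 * ε x - Z x) ∂P := by
    have hZR (x : Ω) : conj (Z x) * (2 * ε x - Z x) =
        ∑ i, conj (c i) * (S i x * (2 * ε x - Z x)) := by
      simp only [Z, map_sum, map_mul, Complex.conj_ofReal]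
      rw [Finset.sum_mul]
      exact Finset.sum_congr rfl fun i _ => by ring
    simp only [hZR]
    rw [integral_finsetSum _ fun i _ => (integrable_ofReal_mul (hS i) hR).const_mul _]
    simp only [integral_const_mul, hSR]
    rfl
  have hpoint (x : Ω) : (conj (Z x) * (2 * ε x - Z x)).re ≤ ‖ε x‖ ^ 2 := by
    rw [Complex.sq_norm, Complex.normSq_apply]
    simp only [Complex.mul_re, Complex.sub_re, Complex.sub_im, Complex.conj_re, Complex.conj_im,
      Complex.mul_im, Complex.re_ofNat, Complex.im_ofNat]
    nlinarith [sq_nonneg ((ε x).re - (Z x).re), sq_nonneg ((ε x).im - (Z x).im)]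
  have hint : Integrable (fun x => conj (Z x) * (2 * ε x - Z x)) P := hZ.star.integrable_mul hR
  rw [hconj, ← RCLike.re_eq_complex_re, ← integral_re hint]
  exact integral_mono hint.re hε.norm.integrable_sq hpoint

lemma map_ofReal_mulVec_inv_mulVec [DecidableEq n] {J : Matrix n n ℝ} (hJ : IsUnit J.det)
    (v : n → ℂ) : J.map Complex.ofReal *ᵥ J⁻¹.map Complex.ofReal *ᵥ v = v := by
  have hmul : J.map Complex.ofReal * J⁻¹.map Complex.ofReal = 1 := by
    have h := (Matrix.map_mul (L := J) (M := J⁻¹) (f := Complex.ofRealHom)).symm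
    rw [Matrix.mul_nonsing_inv _ hJ] at h
    exact h.trans (Matrix.map_one _ (map_zero _) (map_one _))
  rw [Matrix.mulVec_mulVec, hmul, Matrix.one_mulVec]

lemma re_dotProduct_inv_mulVec_le_of_tendsto [DecidableEq n] {τ : Type*} {l : Filter τ} [l.NeBot]
    {D : τ → n → Ω → ℝ} {ε : Ω → ℂ} {v : n → ℂ} {J : Matrix n n ℝ}
    (hD : ∀ t i, MemLp (D t i) 2 P) (hε : MemLp ε 2 P)
    (hv : ∀ i, Tendsto (fun t => ∫ x, D t i x * ε x ∂P) l (𝓝 (v i)))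
    (hJ : ∀ i j, Tendsto (fun t => ∫ x, D t i x * D t j x ∂P) l (𝓝 (J i j)))
    (hdet : IsUnit J.det) :
    (v ⬝ᵥ J⁻¹.map Complex.ofReal *ᵥ star v).re ≤ ∫ x, ‖ε x‖ ^ 2 ∂P := by
  set c : n → ℂ := J⁻¹.map Complex.ofReal *ᵥ v with hc
  have hstar : star c = J⁻¹.map Complex.ofReal *ᵥ star v := by
    ext i
    simp [hc, Matrix.mulVec, dotProduct]
  have hcont : Continuous fun z : (n → ℂ) × Matrix n n ℝ =>
      (star c ⬝ᵥ ((2 : ℂ) • z.1 - z.2.map Complex.ofReal *ᵥ c)).re := by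
    have hmul : Continuous fun z : (n → ℂ) × Matrix n n ℝ => z.2.map Complex.ofReal *ᵥ c :=
      (continuous_snd.matrix_map Complex.continuous_ofReal).matrix_mulVec continuous_const
    have hsub : Continuous fun z : (n → ℂ) × Matrix n n ℝ =>
        (2 : ℂ) • z.1 - z.2.map Complex.ofReal *ᵥ c :=
      (continuous_fst.fun_const_smul 2).fun_sub hmul
    exact Complex.continuous_re.comp (continuous_const.dotProduct hsub)
  have hlim := (hcont.tendsto (v, J)).comp ((tendsto_pi_nhds.2 hv).prodMk_nhds
    (tendsto_pi_nhds.2 fun i => tendsto_pi_nhds.2 (hJ i)))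
  have hval : star c ⬝ᵥ ((2 : ℂ) • v - J.map Complex.ofReal *ᵥ c) =
      v ⬝ᵥ J⁻¹.map Complex.ofReal *ᵥ star v := by
    rw [map_ofReal_mulVec_inv_mulVec hdet, two_smul, add_sub_cancel_right, hstar, dotProduct_comm]
  rw [← hval]
  exact le_of_tendsto' hlim fun t => re_star_dotProduct_le_integral_norm_sq (hD t) hε c

end ChapmanRobbins

lemma tendsto_exp_sq_mul_sub_one_div_sq {x : ℝ → ℝ} {b : ℝ} (hx : Tendsto x (𝓝[≠] 0) (𝓝 b)) :
    Tendsto (fun t => (Real.exp (t ^ 2 * x t) - 1) / t ^ 2) (𝓝[≠] 0) (𝓝 b) := by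
  have hsq : Tendsto (fun t : ℝ => t ^ 2 * x t) (𝓝[≠] 0) (𝓝 0) := by
    have hpow : Tendsto (fun t : ℝ => t ^ 2) (𝓝[≠] 0) (𝓝 0) := by
      simpa using ((continuous_pow 2).tendsto (0 : ℝ)).mono_left nhdsWithin_le_nhds
    simpa using hpow.mul hx
  have hslope : Tendsto (fun t => dslope Real.exp 0 (t ^ 2 * x t)) (𝓝[≠] 0) (𝓝 1) := by
    have hc : ContinuousAt (dslope Real.exp 0) 0 :=
      continuousAt_dslope_same.2 Real.differentiableAt_exp
    have h1 : dslope Real.exp 0 0 = 1 := by simp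
    exact h1 ▸ hc.tendsto.comp hsq
  refine (mul_one b ▸ hx.mul hslope).congr' ?_
  filter_upwards [self_mem_nhdsWithin] with t ht
  have ht : t ≠ 0 := ht
  have hmul : t ^ 2 * x t * dslope Real.exp 0 (t ^ 2 * x t) = Real.exp (t ^ 2 * x t) - 1 := by
    simpa using sub_smul_dslope Real.exp 0 (t ^ 2 * x t)
  rw [← hmul]
  field_simp

lemma memLp_two_and_integral_sq_of_mgf_eq {Ω : Type*} [MeasurableSpace Ω] {P : Measure Ω}
    [IsProbabilityMeasure P] {X : Ω → ℝ} {v : ℝ}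
    (h : mgf X P = fun t => Real.exp (t ^ 2 * v / 2)) :
    MemLp X 2 P ∧ ∫ x, X x ^ 2 ∂P = v := by
  have hset : integrableExpSet X P = Set.univ := by
    refine Set.eq_univ_of_forall fun t => mgf_pos_iff.1 ?_
    rw [h]
    exact Real.exp_pos _
  have h0 : 0 ∈ interior (integrableExpSet X P) := by
    rw [hset, interior_univ]
    exact Set.mem_univ 0
  refine ⟨by exact_mod_cast memLp_of_mem_interior_integrableExpSet h0 2, ?_⟩
  have hderiv : deriv (mgf X P) = fun t => Real.exp (t ^ 2 * v / 2) * (t * v) := by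
    ext t
    rw [h]
    refine HasDerivAt.deriv ?_
    convert! (((hasDerivAt_pow 2 t).mul_const v).div_const 2).exp using 1
    push_cast
    ring
  calc ∫ x, X x ^ 2 ∂P = iteratedDeriv 2 (mgf X P) 0 := (iteratedDeriv_mgf_zero h0 2).symm
    _ = v := by
      rw [iteratedDeriv_succ, iteratedDeriv_one, hderiv]
      refine HasDerivAt.deriv ?_
      convert! (((hasDerivAt_pow 2 (0 : ℝ)).mul_const v).div_const 2).exp.mul
        ((hasDerivAt_id (0 : ℝ)).mul_const v) using 1
      simp

section GaussianShift

variable {E : Type*}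

/-- The likelihood ratio, at the observation `y`, of the Gaussian laws centred at `m + Δ` and
at `m`. The bilinear form `B` is the inner product of the Cameron–Martin space. -/
noncomputable def likelihoodRatio [AddCommGroup E] [Module ℝ E] (B : LinearMap.BilinForm ℝ E)
    (m Δ y : E) : ℝ :=
  Real.exp (B Δ (y - m) - B Δ Δ / 2)

/-- The family `P` of laws, indexed by their means, consists of the translates of a Gaussian law
with precision form `B`. Gaussianity is encoded by the Cameron–Martin formula. -/
structure IsGaussianShift [AddCommGroup E] [Module ℝ E] [MeasurableSpace E]
    (B : LinearMap.BilinForm ℝ E) (P : E → Measure E) : Prop where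
  isSymm : B.IsSymm
  isProbabilityMeasure (m : E) : IsProbabilityMeasure (P m)
  add_eq_withDensity (m Δ : E) :
    P (m + Δ) = (P m).withDensity fun y => ENNReal.ofReal (likelihoodRatio B m Δ y)

section Algebra

variable [AddCommGroup E] [Module ℝ E]

lemma likelihoodRatio_pos (B : LinearMap.BilinForm ℝ E) (m Δ y : E) :
    0 < likelihoodRatio B m Δ y :=
  Real.exp_pos _

lemma likelihoodRatio_mul {B : LinearMap.BilinForm ℝ E} (hB : B.IsSymm) (m Δ Γ y : E) :
    likelihoodRatio B m Δ y * likelihoodRatio B m Γ y =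
      Real.exp (B Δ Γ) * likelihoodRatio B m (Δ + Γ) y := by
  simp only [likelihoodRatio, ← Real.exp_add, map_add, LinearMap.add_apply, hB.eq Γ Δ]
  ring_nf

end Algebra

variable [NormedAddCommGroup E] [NormedSpace ℝ E] [FiniteDimensional ℝ E] [MeasurableSpace E]
  [BorelSpace E]

lemma measurable_bilinForm_sub (B : LinearMap.BilinForm ℝ E) (c m : E) :
    Measurable fun y => B c (y - m) :=
  ((B c).continuous_of_finiteDimensional.comp (continuous_sub_right m)).measurable

lemma measurable_likelihoodRatio (B : LinearMap.BilinForm ℝ E) (m Δ : E) :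
    Measurable (likelihoodRatio B m Δ) :=
  Real.measurable_exp.comp ((measurable_bilinForm_sub B Δ m).sub_const _)

namespace IsGaussianShift

variable {B : LinearMap.BilinForm ℝ E} {P : E → Measure E}

lemma integral_add {G : Type*} [NormedAddCommGroup G] [NormedSpace ℝ G] (h : IsGaussianShift B P)
    (m Δ : E) (f : E → G) :
    ∫ y, f y ∂P (m + Δ) = ∫ y, likelihoodRatio B m Δ y • f y ∂P m := by
  rw [h.add_eq_withDensity, integral_withDensity_eq_integral_toReal_smul
    (measurable_likelihoodRatio B m Δ).ennreal_ofReal (by simp)]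
  simp only [ENNReal.toReal_ofReal (likelihoodRatio_pos B m Δ _).le]

lemma integral_likelihoodRatio (h : IsGaussianShift B P) (m Δ : E) :
    ∫ y, likelihoodRatio B m Δ y ∂P m = 1 := by
  have := h.isProbabilityMeasure (m + Δ)
  simpa using (h.integral_add m Δ fun _ => (1 : ℝ)).symm

lemma integrable_likelihoodRatio (h : IsGaussianShift B P) (m Δ : E) :
    Integrable (likelihoodRatio B m Δ) (P m) :=
  .of_integral_ne_zero ((h.integral_likelihoodRatio m Δ).trans_ne one_ne_zero)

lemma mgf_eq (h : IsGaussianShift B P) (m c : E) :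
    mgf (fun y => B c (y - m)) (P m) = fun t => Real.exp (t ^ 2 * B c c / 2) := by
  ext t
  have hL (y : E) : Real.exp (t * B c (y - m)) =
      Real.exp (t ^ 2 * B c c / 2) * likelihoodRatio B m (t • c) y := by
    rw [likelihoodRatio, ← Real.exp_add]
    simp only [map_smul, LinearMap.smul_apply, smul_eq_mul]
    ring_nf
  simp only [mgf, hL]
  rw [integral_const_mul, h.integral_likelihoodRatio, mul_one]

lemma memLp_two (h : IsGaussianShift B P) (m c : E) : MemLp (fun y => B c (y - m)) 2 (P m) :=
  have := h.isProbabilityMeasure m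
  (memLp_two_and_integral_sq_of_mgf_eq (h.mgf_eq m c)).1

lemma integral_sq (h : IsGaussianShift B P) (m c : E) : ∫ y, B c (y - m) ^ 2 ∂P m = B c c :=
  have := h.isProbabilityMeasure m
  (memLp_two_and_integral_sq_of_mgf_eq (h.mgf_eq m c)).2

lemma integral_mul (h : IsGaussianShift B P) (m c d : E) :
    ∫ y, B c (y - m) * B d (y - m) ∂P m = B c d := by
  have hpol (y : E) : B c (y - m) * B d (y - m) =
      (B (c + d) (y - m) ^ 2 - B c (y - m) ^ 2 - B d (y - m) ^ 2) / 2 := by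
    rw [map_add, LinearMap.add_apply]
    ring
  have hint (e : E) : Integrable (fun y => B e (y - m) ^ 2) (P m) := (h.memLp_two m e).integrable_sq
  simp only [hpol]
  rw [integral_div, integral_sub ((hint _).sub' (hint _)) (hint _), integral_sub (hint _) (hint _)]
  simp only [h.integral_sq]
  simp only [map_add, LinearMap.add_apply, h.isSymm.eq d c]
  ring

lemma memLp_likelihoodRatio (h : IsGaussianShift B P) (m Δ : E) :
    MemLp (likelihoodRatio B m Δ) 2 (P m) := by
  refine (memLp_two_iff_integrable_sq
    (measurable_likelihoodRatio B m Δ).aestronglyMeasurable).2 ?_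
  simp only [sq, likelihoodRatio_mul h.isSymm]
  exact (h.integrable_likelihoodRatio m _).const_mul _

lemma integral_likelihoodRatio_sub_one_mul (h : IsGaussianShift B P) (m Δ Γ : E) :
    ∫ y, (likelihoodRatio B m Δ y - 1) * (likelihoodRatio B m Γ y - 1) ∂P m =
      Real.exp (B Δ Γ) - 1 := by
  have := h.isProbabilityMeasure m
  have hL := h.integrable_likelihoodRatio m
  simp only [sub_one_mul, mul_sub_one, likelihoodRatio_mul h.isSymm]
  rw [integral_sub (((hL _).const_mul _).sub' (hL _)) ((hL _).sub' (integrable_const 1)),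
    integral_sub ((hL _).const_mul _) (hL _), integral_sub (hL _) (integrable_const 1),
    integral_const_mul]
  simp [h.integral_likelihoodRatio]

lemma tendsto_integral_quotient_mul (h : IsGaussianShift B P) {m : E} {Δ Γ : ℝ → E} {c d : E}
    (hΔ : Tendsto (fun t => t⁻¹ • Δ t) (𝓝[≠] 0) (𝓝 c))
    (hΓ : Tendsto (fun t => t⁻¹ • Γ t) (𝓝[≠] 0) (𝓝 d)) :
    Tendsto (fun t => ∫ y, t⁻¹ * (likelihoodRatio B m (Δ t) y - 1) *
      (t⁻¹ * (likelihoodRatio B m (Γ t) y - 1)) ∂P m) (𝓝[≠] 0) (𝓝 (B c d)) := by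
  have hB : Tendsto (fun t => B (t⁻¹ • Δ t) (t⁻¹ • Γ t)) (𝓝[≠] 0) (𝓝 (B c d)) :=
    (B.toContinuousBilinearMap.continuous₂.tendsto (c, d)).comp (hΔ.prodMk_nhds hΓ)
  refine (tendsto_exp_sq_mul_sub_one_div_sq hB).congr' ?_
  filter_upwards [self_mem_nhdsWithin] with t ht
  have ht : t ≠ 0 := ht
  have hBt : t ^ 2 * B (t⁻¹ • Δ t) (t⁻¹ • Γ t) = B (Δ t) (Γ t) := by
    simp only [map_smul, LinearMap.smul_apply, smul_eq_mul]
    field_simp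
  simp only [mul_mul_mul_comm t⁻¹]
  rw [integral_const_mul, h.integral_likelihoodRatio_sub_one_mul, hBt]
  field_simp

lemma integral_quotient_mul_sub (h : IsGaussianShift B P) {m Δ : E} {g : E → ℂ}
    (hg : MemLp g 2 (P m)) (t : ℝ) :
    ∫ y, ((t⁻¹ * (likelihoodRatio B m Δ y - 1) : ℝ) : ℂ) * (g y - ∫ z, g z ∂P m) ∂P m =
      t⁻¹ • ((∫ y, g y ∂P (m + Δ)) - ∫ y, g y ∂P m) := by
  have := h.isProbabilityMeasure m
  set a := ∫ y, g y ∂P m with ha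
  have hLg := integrable_ofReal_mul (h.memLp_likelihoodRatio m Δ) hg
  have hLa : Integrable (fun y => (likelihoodRatio B m Δ y : ℂ) * a) (P m) :=
    (h.integrable_likelihoodRatio m Δ).ofReal.mul_const a
  have hga : Integrable (fun y => g y - a) (P m) :=
    (hg.integrable one_le_two).sub (integrable_const a)
  have hexpand (y : E) : ((t⁻¹ * (likelihoodRatio B m Δ y - 1) : ℝ) : ℂ) * (g y - a) =
      (t : ℂ)⁻¹ * ((likelihoodRatio B m Δ y : ℂ) * g y - (likelihoodRatio B m Δ y : ℂ) * a -
        (g y - a)) := by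
    push_cast
    ring
  simp only [hexpand]
  rw [integral_const_mul, integral_sub (hLg.sub' hLa) hga, integral_sub hLg hLa,
    integral_sub (hg.integrable one_le_two) (integrable_const a), integral_mul_const,
    integral_complex_ofReal, h.integral_likelihoodRatio, h.integral_add]
  simp [← ha]

/-- The Cramér–Rao bound, as the limit of the Chapman–Robbins bounds given by the likelihood
ratios at `ψ + t uᵢ`, `t → 0`. -/
theorem ofReal_re_le_lintegral_norm_sq {F ι : Type*} [NormedAddCommGroup F] [NormedSpace ℝ F]
    [Fintype ι] [DecidableEq ι] (h : IsGaussianShift B P) {m : F → E} {η : F → ℂ} {ψ : F}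
    {u : ι → F} {m' : ι → E} {η' : ι → ℂ} {g : E → ℂ}
    (hm : ∀ i, HasLineDerivAt ℝ m (m' i) ψ (u i)) (hη : ∀ i, HasLineDerivAt ℝ η (η' i) ψ (u i))
    (hg : AEStronglyMeasurable g (P (m ψ))) (hunb : ∀ᶠ φ in 𝓝 ψ, ∫ y, g y ∂P (m φ) = η φ)
    (hdet : IsUnit (Matrix.of fun i j => B (m' i) (m' j)).det) :
    ENNReal.ofReal
        (η' ⬝ᵥ (Matrix.of fun i j => B (m' i) (m' j))⁻¹.map Complex.ofReal *ᵥ star η').re ≤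
      ∫⁻ y, ENNReal.ofReal (‖g y - η ψ‖ ^ 2) ∂P (m ψ) := by
  have := h.isProbabilityMeasure (m ψ)
  have hε : AEStronglyMeasurable (fun y => g y - η ψ) (P (m ψ)) :=
    hg.sub aestronglyMeasurable_const
  by_cases htop : ∫⁻ y, ENNReal.ofReal (‖g y - η ψ‖ ^ 2) ∂P (m ψ) = ⊤
  · exact htop ▸ le_top
  have hsq : Integrable (fun y => ‖g y - η ψ‖ ^ 2) (P (m ψ)) :=
    (lintegral_ofReal_ne_top_iff_integrable (hε.norm.pow 2)
      (Eventually.of_forall fun y => sq_nonneg _)).1 htop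
  have hεL : MemLp (fun y => g y - η ψ) 2 (P (m ψ)) := (memLp_two_iff_integrable_sq_norm hε).2 hsq
  have hgL : MemLp g 2 (P (m ψ)) := by
    simpa [Pi.add_def] using hεL.add (memLp_const (η ψ))
  rw [← ofReal_integral_eq_lintegral_ofReal hsq (Eventually.of_forall fun y => sq_nonneg _)]
  refine ENNReal.ofReal_le_ofReal ?_
  set Δ : ι → ℝ → E := fun i t => m (ψ + t • u i) - m ψ
  have hslope (i : ι) : Tendsto (fun t => t⁻¹ • Δ i t) (𝓝[≠] 0) (𝓝 (m' i)) := by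
    simpa using (hm i).tendsto_slope_zero
  refine re_dotProduct_inv_mulVec_le_of_tendsto
    (D := fun t i y => t⁻¹ * (likelihoodRatio B (m ψ) (Δ i t) y - 1)) (l := 𝓝[≠] 0)
    (fun t i => ((h.memLp_likelihoodRatio _ _).sub (memLp_const 1)).const_mul _) hεL
    (fun i => ?_) (fun i j => h.tendsto_integral_quotient_mul (hslope i) (hslope j)) hdet
  have hline : Tendsto (fun t : ℝ => ψ + t • u i) (𝓝[≠] 0) (𝓝 ψ) := by
    have hc : Continuous fun t : ℝ => ψ + t • u i := by fun_prop
    simpa using (hc.tendsto 0).mono_left nhdsWithin_le_nhds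
  refine (hη i).tendsto_slope_zero.congr' ?_
  filter_upwards [hline.eventually hunb] with t ht
  rw [← hunb.self_of_nhds, h.integral_quotient_mul_sub hgL]
  simp [Δ, ht, hunb.self_of_nhds]

end IsGaussianShift

end GaussianShift

lemma pi_withDensity_ofReal {ι : Type*} [Fintype ι] {X : ι → Type*} [∀ i, MeasurableSpace (X i)]
    {μ : ∀ i, Measure (X i)} [∀ i, SigmaFinite (μ i)] {f : ∀ i, X i → ℝ}
    (hf : ∀ i, Integrable (f i) (μ i)) (h0 : ∀ i x, 0 ≤ f i x) :
    Measure.pi (fun i => (μ i).withDensity fun x => ENNReal.ofReal (f i x)) =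
      (Measure.pi μ).withDensity fun x => ENNReal.ofReal (∏ i, f i (x i)) := by
  have (i : ι) : IsFiniteMeasure ((μ i).withDensity fun x => ENNReal.ofReal (f i x)) :=
    isFiniteMeasure_withDensity_ofReal (hf i).2
  refine Measure.pi_eq fun s hs => ?_
  have hprod : Integrable (fun x : ∀ i, X i => ∏ i, f i (x i)) (Measure.pi μ) :=
    Integrable.fintype_prod_dep hf
  calc (Measure.pi μ).withDensity (fun x => ENNReal.ofReal (∏ i, f i (x i))) (Set.univ.pi s)
      = ENNReal.ofReal (∫ x in Set.univ.pi s, ∏ i, f i (x i) ∂Measure.pi μ) := by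
        rw [withDensity_apply _ (MeasurableSet.univ_pi hs),
          ofReal_integral_eq_lintegral_ofReal hprod.restrict
            (Eventually.of_forall fun x => Finset.prod_nonneg fun i _ => h0 i _)]
    _ = ∏ i, ENNReal.ofReal (∫ x in s i, f i x ∂μ i) := by
        rw [Measure.restrict_pi_pi, integral_fintype_prod_eq_prod,
          ENNReal.ofReal_prod_of_nonneg fun i _ => integral_nonneg (h0 i)]
    _ = ∏ i, (μ i).withDensity (fun x => ENNReal.ofReal (f i x)) (s i) := by
        refine Finset.prod_congr rfl fun i _ => ?_
        rw [withDensity_apply _ (hs i), ofReal_integral_eq_lintegral_ofReal (hf i).restrict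
          (Eventually.of_forall (h0 i))]

section Product

variable {ι : Type*} [Fintype ι] {E : ι → Type*}

/-- The orthogonal sum of bilinear forms, on the product of their spaces: the precision form of
independent Gaussian components. -/
noncomputable def sumForm [∀ i, AddCommGroup (E i)] [∀ i, Module ℝ (E i)]
    (B : ∀ i, LinearMap.BilinForm ℝ (E i)) : LinearMap.BilinForm ℝ (∀ i, E i) :=
  ∑ i, (B i).comp (LinearMap.proj i) (LinearMap.proj i)

lemma sumForm_apply [∀ i, AddCommGroup (E i)] [∀ i, Module ℝ (E i)]
    (B : ∀ i, LinearMap.BilinForm ℝ (E i)) (x y : ∀ i, E i) :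
    sumForm B x y = ∑ i, B i (x i) (y i) := by
  simp [sumForm]

lemma IsGaussianShift.pi [∀ i, NormedAddCommGroup (E i)] [∀ i, NormedSpace ℝ (E i)]
    [∀ i, FiniteDimensional ℝ (E i)] [∀ i, MeasurableSpace (E i)] [∀ i, BorelSpace (E i)]
    {B : ∀ i, LinearMap.BilinForm ℝ (E i)} {P : ∀ i, E i → Measure (E i)}
    (h : ∀ i, IsGaussianShift (B i) (P i)) :
    IsGaussianShift (sumForm B) fun m => Measure.pi fun i => P i (m i) where
  isSymm := ⟨fun x y => by simp only [sumForm_apply, (h _).isSymm.eq (x _)]⟩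
  isProbabilityMeasure m :=
    have (i : ι) := (h i).isProbabilityMeasure (m i)
    inferInstance
  add_eq_withDensity m Δ := by
    have (i : ι) := (h i).isProbabilityMeasure (m i)
    simp only [Pi.add_apply, (h _).add_eq_withDensity]
    rw [pi_withDensity_ofReal (fun i => (h i).integrable_likelihoodRatio _ _)
      fun i y => (likelihoodRatio_pos _ _ _ y).le]
    simp only [likelihoodRatio, ← Real.exp_sum, sumForm_apply, Finset.sum_sub_distrib,
      Finset.sum_div, Pi.sub_apply]

end Product

section ComplexNormal

variable {σ : ℝ}

/-- The density of the circularly symmetric complex normal law `CN(m, σ²)`. -/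
noncomputable def complexNormalPDF (σ : ℝ) (m y : ℂ) : ℝ :=
  1 / (Real.pi * σ ^ 2) * Real.exp (-‖y - m‖ ^ 2 / σ ^ 2)

/-- The circularly symmetric complex normal law `CN(m, σ²)`. -/
noncomputable def complexNormal (σ : ℝ) (m : ℂ) : Measure ℂ :=
  volume.withDensity fun y => ENNReal.ofReal (complexNormalPDF σ m y)

lemma complexNormalPDF_nonneg (σ : ℝ) (m y : ℂ) : 0 ≤ complexNormalPDF σ m y := by
  unfold complexNormalPDF
  positivity

lemma measurable_complexNormalPDF (σ : ℝ) (m : ℂ) : Measurable (complexNormalPDF σ m) := by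
  unfold complexNormalPDF
  fun_prop

lemma integral_complexNormalPDF (hσ : σ ≠ 0) (m : ℂ) : ∫ y, complexNormalPDF σ m y = 1 := by
  have hgauss : ∫ y : ℂ, Real.exp (-‖y‖ ^ 2 / σ ^ 2) = Real.pi * σ ^ 2 := by
    have h := GaussianFourier.integral_rexp_neg_mul_sq_norm (V := ℂ) (b := (σ ^ 2)⁻¹)
      (by positivity)
    simp only [Complex.finrank_real_complex] at h
    simpa [neg_div, div_eq_inv_mul, mul_comm] using h
  simp only [complexNormalPDF]
  rw [integral_const_mul, integral_sub_right_eq_self (fun y : ℂ => Real.exp (-‖y‖ ^ 2 / σ ^ 2)) m,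
    hgauss, one_div_mul_cancel (by positivity)]

lemma integrable_complexNormalPDF (hσ : σ ≠ 0) (m : ℂ) : Integrable (complexNormalPDF σ m) :=
  .of_integral_ne_zero ((integral_complexNormalPDF hσ m).trans_ne one_ne_zero)

lemma isProbabilityMeasure_complexNormal (hσ : σ ≠ 0) (m : ℂ) :
    IsProbabilityMeasure (complexNormal σ m) := by
  refine ⟨?_⟩
  rw [complexNormal, withDensity_apply _ MeasurableSet.univ, Measure.restrict_univ,
    ← ofReal_integral_eq_lintegral_ofReal (integrable_complexNormalPDF hσ m)
      (Eventually.of_forall (complexNormalPDF_nonneg σ m)),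
    integral_complexNormalPDF hσ, ENNReal.ofReal_one]

lemma complexNormalPDF_add (σ : ℝ) (m Δ y : ℂ) :
    complexNormalPDF σ (m + Δ) y =
      complexNormalPDF σ m y * likelihoodRatio ((2 / σ ^ 2) • innerₗ ℂ) m Δ y := by
  have hsq : ‖y - (m + Δ)‖ ^ 2 = ‖y - m‖ ^ 2 - 2 * inner ℝ Δ (y - m) + ‖Δ‖ ^ 2 := by
    rw [← sub_sub, norm_sub_sq_real, real_inner_comm]
  simp only [complexNormalPDF, likelihoodRatio, LinearMap.smul_apply, innerₗ_apply_apply,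
    real_inner_self_eq_norm_sq, smul_eq_mul]
  rw [mul_assoc, ← Real.exp_add, hsq]
  ring_nf

lemma isGaussianShift_complexNormal (hσ : σ ≠ 0) :
    IsGaussianShift ((2 / σ ^ 2) • innerₗ ℂ) (complexNormal σ) where
  isSymm := ⟨fun x y => by simp [real_inner_comm]⟩
  isProbabilityMeasure := isProbabilityMeasure_complexNormal hσ
  add_eq_withDensity m Δ := by
    rw [complexNormal, complexNormal, ← withDensity_mul _
      (measurable_complexNormalPDF σ m).ennreal_ofReal
      (measurable_likelihoodRatio _ m Δ).ennreal_ofReal]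
    congr with y
    rw [Pi.mul_apply, complexNormalPDF_add, ENNReal.ofReal_mul (complexNormalPDF_nonneg _ _ _)]

variable {ι : Type*} [Fintype ι]

/-- The law of a complex vector with independent entries `CN(mᵢ, σ²)`. -/
noncomputable def complexNormalVector (σ : ℝ) (m : ι → ℂ) : Measure (ι → ℂ) :=
  Measure.pi fun i => complexNormal σ (m i)

/-- The precision form `2 / σ² Re(xᴴ y)` of a complex vector with independent entries of
variance `σ²`. -/
noncomputable def noiseForm (σ : ℝ) : LinearMap.BilinForm ℝ (ι → ℂ) :=
  sumForm fun _ => (2 / σ ^ 2) • innerₗ ℂ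

lemma noiseForm_apply (σ : ℝ) (x y : ι → ℂ) :
    noiseForm σ x y = 2 / σ ^ 2 * (star x ⬝ᵥ y).re := by
  simp [noiseForm, sumForm_apply, Complex.inner, dotProduct, Finset.mul_sum, mul_comm]

lemma noiseForm_self (σ : ℝ) (x : ι → ℂ) : noiseForm σ x x = 2 / σ ^ 2 * ∑ i, ‖x i‖ ^ 2 := by
  simp [noiseForm, sumForm_apply, Finset.mul_sum]

lemma noiseForm_col {κ : Type*} (σ : ℝ) (A : Matrix ι κ ℂ) (i j : κ) :
    noiseForm σ (A.col i) (A.col j) = 2 / σ ^ 2 * ((Aᴴ * A) i j).re :=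
  noiseForm_apply σ _ _

lemma isGaussianShift_complexNormalVector (hσ : σ ≠ 0) :
    IsGaussianShift (noiseForm σ) (complexNormalVector (ι := ι) σ) :=
  .pi fun _ => isGaussianShift_complexNormal hσ

end ComplexNormal

lemma differentiable_channel (M N : ℕ) (p : Fin M × Fin N) :
    Differentiable ℝ fun φ : Param => channel M N φ p := by
  unfold channel gain steering steering1
  fun_prop

lemma hasLineDerivAt_channel (M N : ℕ) (ψ : Param) (p : Fin M × Fin N) (i : Fin 4) :
    HasLineDerivAt ℝ (fun φ => channel M N φ p) (jacobian M N ψ p i) ψ (Pi.single i 1) :=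
  (differentiable_channel M N p ψ).hasFDerivAt.hasLineDerivAt (Pi.single i 1)

lemma jacobian_apply_eq_deriv (M N : ℕ) (ψ : Param) (p : Fin M × Fin N) (i : Fin 4) :
    jacobian M N ψ p i = deriv (fun t => channel M N (Function.update ψ i t) p) (ψ i) := by
  refine (HasDerivAt.deriv ?_).symm
  refine HasFDerivAt.comp_hasDerivAt (ψ i) (l := fun φ => channel M N φ p) ?_
    (hasDerivAt_update ψ i (ψ i))
  rw [Function.update_eq_self]
  exact (differentiable_channel M N p ψ).hasFDerivAt

lemma jacobian_eq (M N : ℕ) (ψ : Param) :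
    jacobian M N ψ = Matrix.of fun p =>
      ![steering M N (ψ 2) (ψ 3) p,
        Complex.I * steering M N (ψ 2) (ψ 3) p,
        gain ψ * deriv (fun t : ℝ => steering M N t (ψ 3) p) (ψ 2),
        gain ψ * deriv (fun t : ℝ => steering M N (ψ 2) t p) (ψ 3)] := by
  ext p i
  rw [jacobian_apply_eq_deriv]
  have hofReal (x : ℝ) : HasDerivAt (fun t : ℝ => (t : ℂ)) 1 x := Complex.ofRealCLM.hasDerivAt
  fin_cases i
  · simpa [channel, gain] using (((hofReal (ψ 0)).add_const (ψ 1 * Complex.I)).mul_const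
      (steering M N (ψ 2) (ψ 3) p)).deriv
  · simpa [channel, gain] using ((((hofReal (ψ 1)).mul_const Complex.I).const_add
      (ψ 0 : ℂ)).mul_const (steering M N (ψ 2) (ψ 3) p)).deriv
  · simp [channel, gain]
  · simp [channel, gain]

section Observation

variable {M N q : ℕ} {σ : ℝ} (r : ℝ) (W : Matrix (Fin M × Fin N) (Fin q) ℂ) (ψ : Param)

/-- The Jacobian matrix `|s| Wᴴ V` of the mean of an observation vector. -/
noncomputable def obsMeanJacobian : Matrix (Fin q) (Fin 4) ℂ :=
  (r : ℂ) • (Wᴴ * jacobian M N ψ)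

lemma differentiable_obsMean : Differentiable ℝ (obsMean r W) := by
  refine differentiable_pi.2 fun a => ?_
  simp only [obsMean, Pi.smul_apply, Matrix.mulVec, dotProduct, smul_eq_mul]
  exact (Differentiable.fun_sum fun p _ => (differentiable_channel M N p).const_mul _).const_mul _

lemma hasLineDerivAt_obsMean (i : Fin 4) :
    HasLineDerivAt ℝ (obsMean r W) ((obsMeanJacobian r W ψ).col i) ψ (Pi.single i 1) := by
  refine hasDerivAt_pi.2 fun a => ?_
  simp only [obsMean, Pi.smul_apply, Matrix.mulVec, dotProduct, smul_eq_mul]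
  exact (HasDerivAt.fun_sum fun p _ => (hasLineDerivAt_channel M N ψ p i).const_mul _).const_mul _

lemma fderiv_obsMean_single (i : Fin 4) :
    fderiv ℝ (obsMean r W) ψ (Pi.single i 1) = (obsMeanJacobian r W ψ).col i :=
  ((differentiable_obsMean r W ψ).hasFDerivAt.hasLineDerivAt _).unique
    (hasLineDerivAt_obsMean r W ψ i)

lemma conjTranspose_obsMeanJacobian_mul_self :
    (obsMeanJacobian r W ψ)ᴴ * obsMeanJacobian r W ψ =
      ((r ^ 2 : ℝ) : ℂ) • ((jacobian M N ψ)ᴴ * W * Wᴴ * jacobian M N ψ) := by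
  simp only [obsMeanJacobian, Matrix.conjTranspose_smul, Matrix.conjTranspose_mul,
    Matrix.conjTranspose_conjTranspose, Matrix.smul_mul, Matrix.mul_smul, smul_smul,
    Matrix.mul_assoc, RCLike.star_def, Complex.conj_ofReal, sq, Complex.ofReal_mul]

lemma obsDensity_eq_prod (y : Fin q → ℂ) :
    obsDensity r σ W ψ y = ∏ i, complexNormalPDF σ (obsMean r W ψ i) (y i) := by
  simp only [complexNormalPDF, Finset.prod_mul_distrib, ← Real.exp_sum, obsDensity,
    ← Finset.sum_div, Finset.sum_neg_distrib]
  simp [mul_pow, ← pow_mul]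

lemma obsLaw_eq_complexNormalVector (hσ : σ ≠ 0) :
    obsLaw r σ W ψ = complexNormalVector σ (obsMean r W ψ) := by
  simp only [obsLaw, complexNormalVector, complexNormal, obsDensity_eq_prod]
  rw [pi_withDensity_ofReal (fun i => integrable_complexNormalPDF hσ _)
    fun i => complexNormalPDF_nonneg σ _]
  rfl

lemma log_obsDensity (hσ : σ ≠ 0) (y : Fin q → ℂ) :
    Real.log (obsDensity r σ W ψ y) = Real.log (1 / (Real.pi ^ q * σ ^ (2 * q))) -
      noiseForm σ (y - obsMean r W ψ) (y - obsMean r W ψ) / 2 := by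
  rw [obsDensity, Real.log_mul (by positivity) (Real.exp_ne_zero _), Real.log_exp, noiseForm_self]
  simp only [Pi.sub_apply]
  ring

lemma score_eq (hσ : σ ≠ 0) (y : Fin q → ℂ) (i : Fin 4) :
    score r σ W ψ y i = noiseForm σ ((obsMeanJacobian r W ψ).col i) (y - obsMean r W ψ) := by
  have hres := (differentiable_obsMean r W ψ).hasFDerivAt.const_sub y
  have hlog := (((noiseForm σ).toContinuousBilinearMap.hasFDerivAt_of_bilinear hres hres).mul_const
    (2⁻¹ : ℝ)).const_sub (Real.log (1 / (Real.pi ^ q * σ ^ (2 * q))))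
  simp only [LinearMap.toContinuousBilinearMap_apply] at hlog
  simp only [score, log_obsDensity r W _ hσ, div_eq_mul_inv _ (2 : ℝ)]
  rw [hlog.fderiv]
  set z := y - obsMean r W ψ
  change -(2⁻¹ * (noiseForm σ z (-fderiv ℝ (obsMean r W) ψ (Pi.single i 1)) +
    noiseForm σ (-fderiv ℝ (obsMean r W) ψ (Pi.single i 1)) z)) = _
  rw [fderiv_obsMean_single, map_neg, map_neg, LinearMap.neg_apply,
    (isGaussianShift_complexNormalVector hσ).isSymm.eq _ z]
  ring

lemma integrable_score_mul (hσ : σ ≠ 0) (i j : Fin 4) :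
    Integrable (fun y => score r σ W ψ y i * score r σ W ψ y j) (obsLaw r σ W ψ) := by
  have h := isGaussianShift_complexNormalVector (ι := Fin q) hσ
  simp only [score_eq r W ψ hσ]
  rw [obsLaw_eq_complexNormalVector r W ψ hσ]
  exact (h.memLp_two _ _).integrable_mul (h.memLp_two _ _)

lemma fisher_apply (hσ : σ ≠ 0) (i j : Fin 4) :
    fisher r σ W ψ i j =
      noiseForm σ ((obsMeanJacobian r W ψ).col i) ((obsMeanJacobian r W ψ).col j) := by
  simp only [fisher, Matrix.of_apply, score_eq r W ψ hσ]
  rw [obsLaw_eq_complexNormalVector r W ψ hσ]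
  exact (isGaussianShift_complexNormalVector hσ).integral_mul _ _ _

lemma fisher_eq (hσ : σ ≠ 0) :
    fisher r σ W ψ = (2 * r ^ 2 / σ ^ 2) •
      ((jacobian M N ψ)ᴴ * W * Wᴴ * jacobian M N ψ).map Complex.re := by
  ext i j
  rw [fisher_apply r W ψ hσ, noiseForm_col, conjTranspose_obsMeanJacobian_mul_self,
    Matrix.smul_apply, Matrix.smul_apply, Matrix.map_apply, smul_eq_mul, smul_eq_mul,
    Complex.re_ofReal_mul]
  ring

lemma fisher_isSymm (σ : ℝ) : (fisher r σ W ψ).IsSymm := by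
  ext i j
  simp only [fisher, Matrix.transpose_apply, Matrix.of_apply, mul_comm]

end Observation

section Bound

lemma isHermitian_map_ofReal {n : Type*} {K : Matrix n n ℝ} (hK : K.IsSymm) :
    (K.map Complex.ofReal).IsHermitian := by
  ext i j
  simp [hK.apply i j]

lemma im_trace_mul_eq_zero {n : Type*} [Fintype n] {A B : Matrix n n ℂ} (hA : A.IsHermitian)
    (hB : B.IsHermitian) : (A * B).trace.im = 0 := by
  rw [← Complex.conj_eq_iff_im, starRingEnd_apply, ← Matrix.trace_conjTranspose,
    Matrix.conjTranspose_mul, hA.eq, hB.eq, Matrix.trace_mul_comm]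

lemma trace_mul_conjTranspose_mul_self {m n : Type*} [Fintype m] [Fintype n] (K : Matrix n n ℂ)
    (V : Matrix m n ℂ) : (K * (Vᴴ * V)).trace = ∑ p, V p ⬝ᵥ K *ᵥ star (V p) := by
  rw [← Matrix.mul_assoc, Matrix.trace_mul_comm]
  rfl

variable {M N q k : ℕ} {σ : ℝ} (r : ℝ) (W : Fin k → Matrix (Fin M × Fin N) (Fin q) ℂ) (ψ : Param)

lemma jointLaw_eq (hσ : σ ≠ 0) :
    jointLaw r σ W ψ = Measure.pi fun l => complexNormalVector σ (obsMean r (W l) ψ) := by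
  simp only [jointLaw, obsLaw_eq_complexNormalVector r _ ψ hσ]

lemma sum_fisher_eq_gram (hσ : σ ≠ 0) :
    ∑ l, fisher r σ (W l) ψ = Matrix.of fun i j =>
      sumForm (fun _ : Fin k => noiseForm σ) (fun l => (obsMeanJacobian r (W l) ψ).col i)
        fun l => (obsMeanJacobian r (W l) ψ).col j := by
  ext i j
  simp only [Matrix.sum_apply, fisher_apply r _ ψ hσ, Matrix.of_apply, sumForm_apply]

variable {g : (Fin k → Fin q → ℂ) → Fin M × Fin N → ℂ}

lemma ofReal_re_le_lintegral_entry_error_sq (hσ : σ ≠ 0)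
    (hdet : IsUnit (∑ l, fisher r σ (W l) ψ).det) (hg : ∀ᶠ φ in 𝓝 ψ, UnbiasedAt r σ W g φ)
    (p : Fin M × Fin N) :
    ENNReal.ofReal (jacobian M N ψ p ⬝ᵥ
        (∑ l, fisher r σ (W l) ψ)⁻¹.map Complex.ofReal *ᵥ star (jacobian M N ψ p)).re ≤
      ∫⁻ y, ENNReal.ofReal (‖g y p - channel M N ψ p‖ ^ 2) ∂jointLaw r σ W ψ := by
  have hshift : IsGaussianShift (sumForm fun _ : Fin k => noiseForm (ι := Fin q) σ)
      fun m => Measure.pi fun l => complexNormalVector σ (m l) :=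
    .pi fun _ => isGaussianShift_complexNormalVector hσ
  simp only [UnbiasedAt, jointLaw_eq r W _ hσ] at hg
  rw [sum_fisher_eq_gram r W ψ hσ] at hdet ⊢
  rw [jointLaw_eq r W ψ hσ]
  have hmean (i : Fin 4) : HasLineDerivAt ℝ (fun φ l => obsMean r (W l) φ)
      (fun l => (obsMeanJacobian r (W l) ψ).col i) ψ (Pi.single i 1) :=
    hasDerivAt_pi.2 fun l => hasLineDerivAt_obsMean r (W l) ψ i
  exact (hshift.ofReal_re_le_lintegral_norm_sq hmean (hasLineDerivAt_channel M N ψ p)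
    (hg.self_of_nhds p).1.aestronglyMeasurable (hg.mono fun φ hφ => (hφ p).2) hdet :)

lemma crlb_eq_ofReal_mul_trace (σ : ℝ) :
    crlb r σ W ψ = ((1 / ((M : ℝ) * N) : ℝ) : ℂ) *
      ((∑ l, fisher r σ (W l) ψ)⁻¹.map Complex.ofReal *
        ((jacobian M N ψ)ᴴ * jacobian M N ψ)).trace := by
  rw [crlb]
  push_cast
  rfl

lemma im_crlb (σ : ℝ) : (crlb r σ W ψ).im = 0 := by
  have hJ : (∑ l, fisher r σ (W l) ψ)⁻¹.IsSymm :=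
    Matrix.IsSymm.inv <| by
      simp [Matrix.IsSymm, Matrix.transpose_sum, (fisher_isSymm r (W _) ψ σ).eq]
  rw [crlb_eq_ofReal_mul_trace, Complex.im_ofReal_mul,
    im_trace_mul_eq_zero (isHermitian_map_ofReal hJ) (Matrix.isHermitian_conjTranspose_mul_self _),
    mul_zero]

lemma ofReal_re_crlb_le_mse (hσ : σ ≠ 0) (hdet : IsUnit (∑ l, fisher r σ (W l) ψ).det)
    (hg : ∀ᶠ φ in 𝓝 ψ, UnbiasedAt r σ W g φ) :
    ENNReal.ofReal (crlb r σ W ψ).re ≤ mse r σ W g ψ := by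
  have hmeas (p : Fin M × Fin N) :
      AEMeasurable (fun y => ENNReal.ofReal (‖g y p - channel M N ψ p‖ ^ 2)) (jointLaw r σ W ψ) :=
    (((hg.self_of_nhds p).1.aestronglyMeasurable.aemeasurable.sub_const _).norm.pow_const
      2).ennreal_ofReal
  have hnonneg : 0 ≤ 1 / ((M : ℝ) * N) := by positivity
  rw [crlb_eq_ofReal_mul_trace, mse, Complex.re_ofReal_mul, ENNReal.ofReal_mul hnonneg,
    trace_mul_conjTranspose_mul_self, Complex.re_sum]
  gcongr
  simp only [ENNReal.ofReal_sum_of_nonneg fun p _ => sq_nonneg ‖g _ p - channel M N ψ p‖]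
  rw [lintegral_finsetSum' _ fun p _ => hmeas p]
  refine (Finset.le_sum_of_subadditive _ ENNReal.ofReal_zero.le
    (fun _ _ => ENNReal.ofReal_add_le) _ _).trans (Finset.sum_le_sum fun p _ => ?_)
  exact ofReal_re_le_lintegral_entry_error_sq r W ψ hσ hdet hg p

end Bound

end BeamTracking

theorem lemma2 {M N q L : ℕ} (hM : 0 < M) (hN : 0 < N)
    (s : EuclideanSpace ℂ (Fin L)) (σ : ℝ) (hσ : 0 < σ) (ψ : BeamTracking.Param) :
    -- the Jacobian matrix
    (BeamTracking.jacobian M N ψ = Matrix.of fun p =>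
      ![BeamTracking.steering M N (ψ 2) (ψ 3) p,
        Complex.I * BeamTracking.steering M N (ψ 2) (ψ 3) p,
        BeamTracking.gain ψ * deriv (fun t : ℝ => BeamTracking.steering M N t (ψ 3) p) (ψ 2),
        BeamTracking.gain ψ * deriv (fun t : ℝ => BeamTracking.steering M N (ψ 2) t p) (ψ 3)]) ∧
    -- the Fisher information matrix
    (∀ W : Matrix (Fin M × Fin N) (Fin q) ℂ,
      (∀ i j, MeasureTheory.Integrable
        (fun y => BeamTracking.score ‖s‖ σ W ψ y i * BeamTracking.score ‖s‖ σ W ψ y j)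
        (BeamTracking.obsLaw ‖s‖ σ W ψ)) ∧
      BeamTracking.fisher ‖s‖ σ W ψ = (2 * ‖s‖ ^ 2 / σ ^ 2) •
        ((BeamTracking.jacobian M N ψ).conjTranspose * W * W.conjTranspose *
          BeamTracking.jacobian M N ψ).map Complex.re) ∧
    -- the lower bound of the mean square error
    (∀ (k : ℕ) (W : Fin k → Matrix (Fin M × Fin N) (Fin q) ℂ),
      IsUnit (∑ l, BeamTracking.fisher ‖s‖ σ (W l) ψ).det →
      (BeamTracking.crlb ‖s‖ σ W ψ).im = 0 ∧
      ∀ g : (Fin k → Fin q → ℂ) → Fin M × Fin N → ℂ,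
        (∀ᶠ φ in nhds ψ, BeamTracking.UnbiasedAt ‖s‖ σ W g φ) →
        ENNReal.ofReal (BeamTracking.crlb ‖s‖ σ W ψ).re ≤ BeamTracking.mse ‖s‖ σ W g ψ) := by
  refine ⟨BeamTracking.jacobian_eq M N ψ, fun W => ⟨?_, ?_⟩, fun k W hdet => ⟨?_, fun g hg => ?_⟩⟩
  · exact BeamTracking.integrable_score_mul ‖s‖ W ψ hσ.ne'
  · exact BeamTracking.fisher_eq ‖s‖ W ψ hσ.ne'
  · exact BeamTracking.im_crlb ‖s‖ W ψ σ
  · exact BeamTracking.ofReal_re_crlb_le_mse ‖s‖ W ψ hσ.ne' hdet hg
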